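/- Let $n,m\ge 0$ be integers and $q=\max(n,m)$. The symmetric linear deterministic interference channel has two transmitters $\mathsf T_1,\mathsf T_2$ and two receivers $\mathsf D_1,\mathsf D_2$. At each time $j$, $\mathsf T_u$ sends $X_{uj}\in\mathbb F_2^q$ and the receivers obtain $$Y_{1j}=\mathbf S^{q-n}X_{1j}\oplus\mathbf S^{q-m}X_{2j},\qquad Y_{2j}=\mathbf S^{q-m}X_{1j}\oplus\mathbf S^{q-n}X_{2j},$$ where $\mathbf S^{s}$ is the $q\times q$ matrix over $\mathbb F_2$ whose $(i,k)$ entry is $1$ if $i=s+k$ and $0$ otherwise (a shift down by $s$ positions). A feedback model is a tuple $(F_{11}F_{12}F_{21}F_{22})\in\{0,1\}^4$, where $F_{ku}=1$ means that there is a noiseless, strictly causal output feedback link from $\mathsf D_k$ to $\mathsf T_u$. For $R_1,R_2\ge 0$ and blocklength $N$, let $W_1,W_2$ be independent messages, $W_u$ uniform on a set of $\lceil 2^{NR_u}\rceil$ elements. The encoders are deterministic functions $X_{uj}=f_{uj}(W_u,\,F_{1u}Y_1^{j-1},\,F_{2u}Y_2^{j-1})$, where $Y_k^{j-1}=(Y_{k1},\dots,Y_{k,j-1})$,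 and the decoders are functions $\widehat W_u=h_u(Y_u^N)$. The pair $(R_1,R_2)$ is achievable if there are such codes, one for each $N$, with $\max\{\Pr(\widehat W_1\ne W_1),\Pr(\widehat W_2\ne W_2)\}\to 0$ as $N\to\infty$. The capacity region $\mathcal C^{(F_{11}F_{12}F_{21}F_{22})}$ is the closure of the set of achievable pairs, and the sum-capacity $C_{\mathrm{sum}}^{(F_{11}F_{12}F_{21}F_{22})}$ is the supremum of $R_1+R_2$ over it. Then for all $n,m$ and every feedback model with at least one direct feedback link, i.e. with $F_{11}=1$ or $F_{22}=1$, $$C_{\mathrm{sum}}^{(1000)}=C_{\mathrm{sum}}^{(F_{11}F_{12}F_{21}F_{22})}=C_{\mathrm{sum}}^{(1111)}=(n-m)^++\max(n,m),$$ where $x^+=\max(x,0)$. -/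

import Mathlib

open Filter Topology

namespace DetIC

/-- A channel symbol: a vector of `q` bits, index `0` being the most significant one. -/
abbrev Signal (q : ℕ) : Type := Fin q → ZMod 2

/-- The `q × q` down-shift matrix over `𝔽₂` by `s` positions: the entry `(i, j)` is nonzero exactly
when `i = s + j`. -/
def shiftMatrix (q s : ℕ) : Matrix (Fin q) (Fin q) (ZMod 2) :=
  Matrix.of fun i j => if (i : ℕ) = s + (j : ℕ) then 1 else 0

/-- The number of bit levels of the link from transmitter `u` to receiver `k` in the symmetric
channel: `n` on direct links and `m` on cross links. -/
def gain (n m : ℕ) (u k : Fin 2) : ℕ := if u = k then n else m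

/-- The symmetric linear deterministic interference channel, with `q = max n m`: receiver `k` gets
`S^(q - n₁ₖ) x₁ ⊕ S^(q - n₂ₖ) x₂`. -/
def channelOutput (n m : ℕ) (x : Fin 2 → Signal (max n m)) (k : Fin 2) : Signal (max n m) :=
  (shiftMatrix (max n m) (max n m - gain n m 0 k)).mulVec (x 0) +
    (shiftMatrix (max n m) (max n m - gain n m 1 k)).mulVec (x 1)

/-- A feedback model: `F k u = true` iff there is a feedback link from receiver `k` to
transmitter `u`. -/
abbrev FeedbackModel : Type := Fin 2 → Fin 2 → Bool

/-- The feedback model written `(F₁₁ F₁₂ F₂₁ F₂₂)`. -/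
def model (F₁₁ F₁₂ F₂₁ F₂₂ : Bool) : FeedbackModel := ![![F₁₁, F₁₂], ![F₂₁, F₂₂]]

/-- A block code with blocklength `N`, signals in `𝔽₂^q` and `M u` messages for user `u`.
Time is counted from `0`; the encoder of transmitter `u` at time `j` maps its own message and a
pair of past output sequences (times `0, …, j - 1`, one for each receiver) to a channel input.
Only the encoders at the times `j < N` matter. -/
structure Code (q : ℕ) (M : Fin 2 → ℕ) (N : ℕ) where
  /-- The encoding functions. -/
  encoder : (u : Fin 2) → (j : ℕ) → Fin (M u) → (Fin 2 → Fin j → Signal q) → Signal q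
  /-- The decoding functions. -/
  decoder : (u : Fin 2) → (Fin N → Signal q) → Fin (M u)

/-- `output c F w j k` is the signal received by receiver `k` at time `j` when the message pair `w`
is sent with the code `c` under the feedback model `F`. The past outputs of receiver `k` reach
the encoder of transmitter `u` multiplied by `F k u`. -/
def output {n m N : ℕ} {M : Fin 2 → ℕ} (c : Code (max n m) M N) (F : FeedbackModel)
    (w : (u : Fin 2) → Fin (M u)) (j : ℕ) : Fin 2 → Signal (max n m) :=
  channelOutput n m fun u =>
    c.encoder u j (w u) fun k (i : Fin j) => if F k u then output c F w i.val k else 0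
termination_by j
decreasing_by exact i.isLt

/-- The message that receiver `u` decodes from its `N` outputs. -/
def decoded {n m N : ℕ} {M : Fin 2 → ℕ} (c : Code (max n m) M N) (F : FeedbackModel)
    (w : (u : Fin 2) → Fin (M u)) (u : Fin 2) : Fin (M u) :=
  c.decoder u fun j => output c F w j.val u

/-- The probability that receiver `u` decodes its message wrongly, for independent and uniformly
distributed messages. -/
noncomputable def errorProb {n m N : ℕ} {M : Fin 2 → ℕ} (c : Code (max n m) M N)
    (F : FeedbackModel) (u : Fin 2) : ℝ :=
  ((Finset.univ.filter fun w : (v : Fin 2) → Fin (M v) => decoded c F w u ≠ w u).card : ℝ) /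
    (Fintype.card ((v : Fin 2) → Fin (M v)) : ℝ)

/-- The number `⌈2^(N R)⌉` of messages at rate `R` and blocklength `N`. -/
noncomputable def messageCount (R : Fin 2 → ℝ) (N : ℕ) (u : Fin 2) : ℕ :=
  ⌈(2 : ℝ) ^ ((N : ℝ) * R u)⌉₊

/-- Achievability of a pair of nonnegative rates under the feedback model `F`. -/
def Achievable (n m : ℕ) (F : FeedbackModel) (R : Fin 2 → ℝ) : Prop :=
  (∀ u, 0 ≤ R u) ∧
    ∃ c : (N : ℕ) → Code (max n m) (messageCount R N) N,
      Tendsto (fun N => max (errorProb (c N) F 0) (errorProb (c N) F 1)) atTop (𝓝 0)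

/-- The capacity region: the closure of the set of achievable rate pairs. -/
def capacityRegion (n m : ℕ) (F : FeedbackModel) : Set (Fin 2 → ℝ) :=
  closure {R | Achievable n m F R}

/-- The sum-capacity: the supremum of `R₁ + R₂` over the capacity region, taken in the extended
reals so that no boundedness or non-emptiness is presupposed. -/
noncomputable def sumCapacity (n m : ℕ) (F : FeedbackModel) : EReal :=
  ⨆ R ∈ capacityRegion n m F, ((R 0 + R 1 : ℝ) : EReal)

end DetIC

/-!
The sum-capacity is computed for every feedback model with a direct feedback link, as the sum
`max n m + (n - m)` (with truncated subtraction) of an outer bound and a matching scheme.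

*Outer bound* (`card_decoded_le`, valid for every feedback model). Among the message pairs that are
decoded correctly, the pair is determined by the `N` outputs of receiver `0`, worth `max n m` bits
each, together with the bits of transmitter `1` on the `n - m` levels that receiver `0` does not
see. Indeed the outputs of receiver `0` give message `0`; then, in temporal order, the past outputs
and message `0` give the input of transmitter `0`, subtracting it from the output of receiver `0`
gives the upper `m` bits of transmitter `1`, and so the output of receiver `1` (`output_congr`);
its outputs finally give message `1`. Hence a code with small error has at most about
`2 ^ (N * (max n m + (n - m)))` message pairs.

*Scheme* (`exists_zero_error_code`). Let `a` be a user with a direct feedback link. The other user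
sends fresh bits on all `max n m` levels, except at the last time, when it is silent. From the
feedback, transmitter `a` learns the upper `m` bits of each such signal and repeats them one time
unit later on its own upper `m` levels, with fresh bits of its own on the `n - m` levels below.
Receiver `a` decodes backwards in time: the repeated bits are the interference of the previous time
(`relayCode_determines_self`). At the other receiver the interference consists of its own previous
bits, and decoding runs forwards if `m ≤ n` and backwards if `n < m`
(`relayCode_determines_other`). The scheme never errs, and its rates tend to `n - m` and `max n m`.
-/

namespace DetIC

/-! ### Shifts and truncations -/

lemma shiftMatrix_mulVec_apply {q s : ℕ} (x : Signal q) (i : Fin q) :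
    (shiftMatrix q s).mulVec x i = if s ≤ (i : ℕ) then x ⟨i - s, by omega⟩ else 0 := by
  simp only [Matrix.mulVec, dotProduct, shiftMatrix, Matrix.of_apply, ite_mul, one_mul, zero_mul]
  split_ifs with h
  · rw [Finset.sum_eq_single (⟨i - s, by omega⟩ : Fin q)]
    · rw [if_pos]
      simp only
      omega
    · intro b _ hb
      rw [if_neg]
      intro h'
      apply hb
      ext
      simp only
      omega
    · simp
  · exact Finset.sum_eq_zero fun j _ => if_neg (by omega)

/-- A link with `g` levels carries exactly the `g` most significant bits. -/
lemma shiftMatrix_mulVec_eq_iff {q g : ℕ} (hg : g ≤ q) (x y : Signal q) :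
    (shiftMatrix q (q - g)).mulVec x = (shiftMatrix q (q - g)).mulVec y ↔
      ∀ i : Fin q, (i : ℕ) < g → x i = y i := by
  constructor
  · intro h i hi
    have := congrFun h ⟨i + (q - g), by omega⟩
    simpa [shiftMatrix_mulVec_apply] using this
  · intro h
    ext i
    rw [shiftMatrix_mulVec_apply, shiftMatrix_mulVec_apply]
    split_ifs with hi
    · exact h _ (by simp only; omega)
    · rfl

/-- The restriction of a signal to its `g` most significant levels. -/
def topBits {q : ℕ} (g : ℕ) (x : Signal q) : Signal q := fun i => if (i : ℕ) < g then x i else 0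

@[simp] lemma topBits_zero {q : ℕ} (g : ℕ) : topBits g (0 : Signal q) = 0 := by
  ext i
  simp [topBits]

/-- The shift up by `q - g` positions, which recovers the `g` most significant bits of a signal
from the output of a link with `g` levels. -/
def shiftUp {q : ℕ} (g : ℕ) (y : Signal q) : Signal q :=
  fun i => if h : (i : ℕ) + (q - g) < q then y ⟨i + (q - g), h⟩ else 0

lemma shiftUp_shiftMatrix_mulVec {q g : ℕ} (hg : g ≤ q) (x : Signal q) :
    shiftUp g ((shiftMatrix q (q - g)).mulVec x) = topBits g x := by
  ext i
  by_cases h : (i : ℕ) < g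
  · have h' : (i : ℕ) + (q - g) < q := by omega
    simp [shiftUp, topBits, h, h', shiftMatrix_mulVec_apply]
  · have h' : ¬ (i : ℕ) + (q - g) < q := by omega
    simp [shiftUp, topBits, h, h']

lemma channelOutput_eq (n m : ℕ) (x : Fin 2 → Signal (max n m)) (k : Fin 2) :
    channelOutput n m x k =
      (shiftMatrix (max n m) (max n m - n)).mulVec (x k) +
        (shiftMatrix (max n m) (max n m - m)).mulVec (x (1 - k)) := by
  fin_cases k
  · simp [channelOutput, gain]
  · simp [channelOutput, gain, add_comm]

/-! ### The outer bound -/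

section

variable {n m N : ℕ} {M : Fin 2 → ℕ}

/-- The signal that transmitter `u` sends at time `j`. -/
def input (c : Code (max n m) M N) (F : FeedbackModel) (w : (u : Fin 2) → Fin (M u)) (j : ℕ)
    (u : Fin 2) : Signal (max n m) :=
  c.encoder u j (w u) fun k (i : Fin j) => if F k u then output c F w i.val k else 0

lemma output_eq (c : Code (max n m) M N) (F : FeedbackModel) (w : (u : Fin 2) → Fin (M u))
    (j : ℕ) : output c F w j = channelOutput n m (input c F w j) := by
  rw [output]
  rfl

lemma input_congr {c : Code (max n m) M N} {F : FeedbackModel} {w w' : (u : Fin 2) → Fin (M u)}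
    {j : ℕ} {u : Fin 2} (hw : w u = w' u) (h : ∀ i < j, output c F w i = output c F w' i) :
    input c F w j u = input c F w' j u := by
  unfold input
  rw [hw]
  congr 1
  ext k i : 2
  rw [h i i.isLt]

/-- The bits of transmitter `1` on the levels `m, …, n - 1`, which reach receiver `1` but not
receiver `0`. -/
def privateBits (x : Fin 2 → Signal (max n m)) : Fin (n - m) → ZMod 2 :=
  fun i => x 1 ⟨m + i, by omega⟩

/-- Knowing message `0`, the outputs of receiver `0` and the private bits of transmitter `1`, one
can recompute all outputs in temporal order: past outputs determine the input of transmitter `0`,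
after whose removal the output of receiver `0` shows the `m` most significant bits of
transmitter `1`. -/
lemma output_congr {c : Code (max n m) M N} {F : FeedbackModel}
    {w w' : (u : Fin 2) → Fin (M u)} (hw : w 0 = w' 0)
    (hy : ∀ j < N, output c F w j 0 = output c F w' j 0)
    (hp : ∀ j < N, privateBits (input c F w j) = privateBits (input c F w' j)) :
    ∀ j < N, output c F w j = output c F w' j := by
  intro j
  induction j using Nat.strong_induction_on with
  | _ j ih =>
    intro hj
    have h0 : input c F w j 0 = input c F w' j 0 :=
      input_congr hw fun i hi => ih i hi (hi.trans hj)
    have hj0 := hy j hj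
    have h1 : ∀ i : Fin (max n m), (i : ℕ) < m → input c F w j 1 i = input c F w' j 1 i := by
      rw [output_eq, output_eq, channelOutput_eq, channelOutput_eq, h0] at hj0
      exact (shiftMatrix_mulVec_eq_iff (le_max_right n m) _ _).1 (add_left_cancel hj0)
    have h2 : ∀ i : Fin (max n m), (i : ℕ) < n → input c F w j 1 i = input c F w' j 1 i := by
      intro i hi
      by_cases him : (i : ℕ) < m
      · exact h1 i him
      · have := congrFun (hp j hj) ⟨i - m, by omega⟩
        have hi' : m + ((i : ℕ) - m) = i := by omega
        simpa only [privateBits, hi'] using this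
    have h3 := (shiftMatrix_mulVec_eq_iff (le_max_left n m) _ _).2 h2
    ext k : 1
    fin_cases k
    · exact hj0
    · simp only [Fin.mk_one]
      rw [output_eq, output_eq, channelOutput_eq, channelOutput_eq, h3]
      simp [h0]

/-- The counting form of the outer bound: on message pairs that are decoded correctly, the pair is
determined by the outputs of receiver `0` and the private bits of transmitter `1`. -/
lemma card_decoded_le (c : Code (max n m) M N) (F : FeedbackModel) :
    (Finset.univ.filter fun w : (v : Fin 2) → Fin (M v) => ∀ u, decoded c F w u = w u).card ≤
      2 ^ (N * (max n m + (n - m))) := by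
  let f : ((v : Fin 2) → Fin (M v)) →
      (Fin N → Signal (max n m)) × (Fin N → Fin (n - m) → ZMod 2) :=
    fun w => (fun j => output c F w j 0, fun j => privateBits (input c F w j))
  have hcard : (Finset.univ : Finset ((Fin N → Signal (max n m)) ×
      (Fin N → Fin (n - m) → ZMod 2))).card = 2 ^ (N * (max n m + (n - m))) := by
    simp only [Finset.card_univ, Fintype.card_prod, Fintype.card_fun, Fintype.card_fin, ZMod.card]
    rw [← pow_mul, ← pow_mul, ← pow_add]
    congr 1
    ring
  rw [← hcard]
  refine Finset.card_le_card_of_injOn f (fun _ _ => Finset.mem_coe.2 (Finset.mem_univ _)) ?_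
  intro w hw w' hw' h
  simp only [Finset.coe_filter, Finset.mem_univ, true_and, Set.mem_ofPred_eq] at hw hw'
  simp only [f, Prod.mk.injEq] at h
  have hy : ∀ j < N, output c F w j 0 = output c F w' j 0 :=
    fun j hj => congrFun h.1 ⟨j, hj⟩
  have hp : ∀ j < N, privateBits (input c F w j) = privateBits (input c F w' j) :=
    fun j hj => congrFun h.2 ⟨j, hj⟩
  have key : ∀ u, (∀ j < N, output c F w j u = output c F w' j u) → w u = w' u := by
    intro u hu
    rw [← hw u, ← hw' u]
    unfold decoded
    congr 1
    ext j : 1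
    exact hu j j.isLt
  have hall := output_congr (key 0 hy) hy hp
  ext u : 1
  exact key u fun j hj => congrFun (hall j hj) u

lemma card_messages_le (c : Code (max n m) M N) (F : FeedbackModel) :
    (1 - errorProb c F 0 - errorProb c F 1) * (M 0 * M 1 : ℝ) ≤
      2 ^ (N * (max n m + (n - m))) := by
  have hcard : (Fintype.card ((v : Fin 2) → Fin (M v)) : ℝ) = M 0 * M 1 := by
    simp [Fintype.card_pi]
  rcases (Fintype.card ((v : Fin 2) → Fin (M v))).eq_zero_or_pos with h0 | hpos
  · rw [← hcard, h0]
    simp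
  have hpos' : (0 : ℝ) < Fintype.card ((v : Fin 2) → Fin (M v)) := by exact_mod_cast hpos
  have hle := card_decoded_le c F
  have hun : Fintype.card ((v : Fin 2) → Fin (M v)) ≤
      (Finset.univ.filter fun w : (v : Fin 2) → Fin (M v) => ∀ u, decoded c F w u = w u).card +
      (Finset.univ.filter fun w : (v : Fin 2) → Fin (M v) => decoded c F w 0 ≠ w 0).card +
      (Finset.univ.filter fun w : (v : Fin 2) → Fin (M v) => decoded c F w 1 ≠ w 1).card := by
    refine le_trans ?_ (add_le_add_left (Finset.card_union_le _ _) _)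
    refine le_trans ?_ (Finset.card_union_le _ _)
    rw [← Finset.card_univ]
    refine Finset.card_le_card fun w _ => ?_
    simp only [Finset.mem_union, Finset.mem_filter, Finset.mem_univ, true_and, Fin.forall_fin_two]
    tauto
  rw [← hcard, sub_mul, sub_mul, errorProb, errorProb, div_mul_cancel₀ _ hpos'.ne',
    div_mul_cancel₀ _ hpos'.ne', one_mul]
  have h1 : ((Finset.univ.filter fun w : (v : Fin 2) → Fin (M v) =>
      ∀ u, decoded c F w u = w u).card : ℝ) ≤ 2 ^ (N * (max n m + (n - m))) := by
    exact_mod_cast hle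
  have h2 : (Fintype.card ((v : Fin 2) → Fin (M v)) : ℝ) ≤ _ := Nat.cast_le.2 hun
  push_cast at h2
  linarith

end

lemma Achievable.sum_le {n m : ℕ} {F : FeedbackModel} {R : Fin 2 → ℝ} (h : Achievable n m F R) :
    R 0 + R 1 ≤ ((max n m + (n - m) : ℕ) : ℝ) := by
  obtain ⟨-, c, hc⟩ := h
  by_contra! hlt
  set C : ℕ := max n m + (n - m)
  -- The number of correctly decoded pairs exceeds `2 ^ (N * C)` once the error is at most `1 / 4`
  -- and `N * (R 0 + R 1 - C) > 1`.
  have hev : ∀ᶠ N : ℕ in atTop, max (errorProb (c N) F 0) (errorProb (c N) F 1) < 1 / 4 :=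
    hc.eventually_lt_const (by norm_num)
  have hev' : ∀ᶠ N : ℕ in atTop, 1 < (N : ℝ) * (R 0 + R 1 - C) :=
    (tendsto_natCast_atTop_atTop.atTop_mul_const (sub_pos.2 hlt)).eventually_gt_atTop 1
  obtain ⟨N, hN, hN'⟩ := (hev.and hev').exists
  have he0 := (max_lt_iff.1 hN).1
  have he1 := (max_lt_iff.1 hN).2
  have hb := card_messages_le (c N) F
  have hM : (2 : ℝ) ^ ((N : ℝ) * (R 0 + R 1)) ≤ messageCount R N 0 * messageCount R N 1 := by
    rw [mul_add, Real.rpow_add two_pos]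
    exact mul_le_mul (Nat.le_ceil _) (Nat.le_ceil _) (by positivity) (by positivity)
  have hlow : (2 : ℝ) * 2 ^ (N * C) < 2 ^ ((N : ℝ) * (R 0 + R 1)) := by
    have : (2 : ℝ) * 2 ^ (N * C) = 2 ^ (1 + (N : ℝ) * C) := by
      rw [Real.rpow_add two_pos, Real.rpow_one, ← Nat.cast_mul, Real.rpow_natCast]
    rw [this]
    exact Real.rpow_lt_rpow_of_exponent_lt one_lt_two (by linarith)
  have hP : (0 : ℝ) ≤ (messageCount R N 0 : ℝ) * messageCount R N 1 := by positivity
  have : (1 / 2 : ℝ) * ((messageCount R N 0 : ℝ) * messageCount R N 1) ≤ 2 ^ (N * C) :=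
    (mul_le_mul_of_nonneg_right (by linarith) hP).trans hb
  linarith

lemma sumCapacity_le (n m : ℕ) (F : FeedbackModel) :
    sumCapacity n m F ≤ (((max n m + (n - m) : ℕ) : ℝ) : EReal) := by
  refine iSup₂_le fun R hR => ?_
  have hcl : IsClosed {R : Fin 2 → ℝ | R 0 + R 1 ≤ ((max n m + (n - m) : ℕ) : ℝ)} :=
    isClosed_le (by fun_prop) continuous_const
  exact EReal.coe_le_coe_iff.2
    (closure_minimal (fun R (h : Achievable n m F R) => h.sum_le) hcl hR)

/-! ### The relaying scheme -/

lemma messageCount_pos (R : Fin 2 → ℝ) (N : ℕ) (u : Fin 2) : 0 < messageCount R N u :=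
  Nat.ceil_pos.2 (by positivity)

section

variable {n m N : ℕ} {M : Fin 2 → ℕ}

lemma output_eq_of_encoder_eq {c c' : Code (max n m) M N} (h : c.encoder = c'.encoder)
    (F : FeedbackModel) (w : (u : Fin 2) → Fin (M u)) (j : ℕ) :
    output c F w j = output c' F w j := by
  induction j using Nat.strong_induction_on with
  | _ j ih =>
    rw [output_eq, output_eq]
    congr 1
    ext u : 1
    unfold input
    rw [h]
    congr 1
    ext k i : 2
    rw [ih i i.isLt]

/-- Encoders for which each receiver's outputs determine its message can be equipped with decoders
that never err. -/
lemma exists_errorProb_eq_zero (c : Code (max n m) M N) (F : FeedbackModel)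
    (h : ∀ u w w', (∀ j < N, output c F w j u = output c F w' j u) → w u = w' u) :
    ∃ c' : Code (max n m) M N, ∀ u, errorProb c' F u = 0 := by
  classical
  let c' : Code (max n m) M N :=
    { encoder := c.encoder
      decoder := fun u y =>
        if hy : ∃ w, (fun j : Fin N => output c F w j u) = y then hy.choose u
        else c.decoder u y }
  refine ⟨c', fun u => ?_⟩
  have hdec : ∀ w, decoded c' F w u = w u := by
    intro w
    have hout : (fun j : Fin N => output c' F w j u) = fun j : Fin N => output c F w j u := by
      ext j : 1
      rw [output_eq_of_encoder_eq (c := c') (c' := c) rfl]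
    have hy : ∃ w', (fun j : Fin N => output c F w' j u) = fun j : Fin N => output c F w j u :=
      ⟨w, rfl⟩
    have : decoded c' F w u = hy.choose u := by
      simp only [decoded, hout]
      exact dif_pos hy
    rw [this]
    exact h u _ _ fun j hj => congrFun hy.choose_spec ⟨j, hj⟩
  simp [errorProb, hdec]

/-- What the relaying transmitter, with data `d`, infers from the outputs `y` of its own receiver:
at time `j + 1`, the `m` most significant bits that the other transmitter sent at time `j`. -/
def relay (n m : ℕ) (d y : ℕ → Signal (max n m)) : ℕ → Signal (max n m)
  | 0 => 0
  | j + 1 => shiftUp m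
      (y j - (shiftMatrix (max n m) (max n m - n)).mulVec (d j + relay n m d y j))

lemma relay_congr {d y y' : ℕ → Signal (max n m)} {j : ℕ} (h : ∀ i < j, y i = y' i) :
    relay n m d y j = relay n m d y' j := by
  induction j with
  | zero => rfl
  | succ j ih => rw [relay, relay, h j j.lt_succ_self, ih fun i hi => h i (hi.trans j.lt_succ_self)]

/-- The code in which transmitter `a` superposes its data `e a` and the bits it relays, while the
other transmitter sends its data uncoded. The decoders are placeholders. -/
def relayCode (N : ℕ) (hM : ∀ u, 0 < M u) (a : Fin 2)
    (e : (u : Fin 2) → Fin (M u) → ℕ → Signal (max n m)) : Code (max n m) M N where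
  encoder u j w y :=
    if u = a then e u w j + relay n m (e u w) (fun i => if h : i < j then y a ⟨i, h⟩ else 0) j
    else e u w j
  decoder u _ := ⟨0, hM u⟩

/-- The signal `x` delayed by one time unit. -/
def delay {q : ℕ} (x : ℕ → Signal q) : ℕ → Signal q
  | 0 => 0
  | j + 1 => x j

variable {hM : ∀ u, 0 < M u} {a : Fin 2} {e : (u : Fin 2) → Fin (M u) → ℕ → Signal (max n m)}
  {F : FeedbackModel}

lemma one_sub_ne (a : Fin 2) : 1 - a ≠ a := by
  fin_cases a <;> decide

lemma input_relayCode_other (w : (u : Fin 2) → Fin (M u)) (j : ℕ) :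
    input (relayCode N hM a e) F w j (1 - a) = e (1 - a) (w (1 - a)) j := by
  simp [input, relayCode, one_sub_ne]

lemma input_relayCode_self (hF : F a a = true) (w : (u : Fin 2) → Fin (M u)) (j : ℕ) :
    input (relayCode N hM a e) F w j a =
      e a (w a) j + topBits m (delay (e (1 - a) (w (1 - a))) j) := by
  set y : ℕ → Signal (max n m) := fun i => output (relayCode N hM a e) F w i a
  have hx : ∀ j, input (relayCode N hM a e) F w j a =
      e a (w a) j + relay n m (e a (w a)) y j := by
    intro j
    simp only [input, relayCode, if_true, hF]
    congr 1
    refine relay_congr fun i hi => ?_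
    simp only [hi, dif_pos]
    rfl
  rw [hx]
  congr 1
  cases j with
  | zero => simp [relay, delay]
  | succ j =>
    rw [relay, ← hx, delay, ← shiftUp_shiftMatrix_mulVec (le_max_right n m)]
    simp only [y]
    rw [output_eq, channelOutput_eq, add_sub_cancel_left, input_relayCode_other]

/-- The relaying user's data is decoded backwards in time: the other transmitter is silent at the
last time, and once its interference at time `j` is known, the output of time `j` reveals both the
data and the interference at time `j - 1`. -/
lemma relayCode_determines_self (hF : F a a = true)
    (hinj : Function.Injective (e a))
    (hlow : ∀ w j (i : Fin (max n m)), (i : ℕ) < m ∨ n ≤ i → e a w j i = 0)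
    (hend : ∀ u w j, N ≤ j + 1 → e u w j = 0) {w w' : (u : Fin 2) → Fin (M u)}
    (h : ∀ j < N, output (relayCode N hM a e) F w j a = output (relayCode N hM a e) F w' j a) :
    w a = w' a := by
  set b := 1 - a
  apply hinj
  have step : ∀ j < N, (∀ i : Fin (max n m), (i : ℕ) < m → e b (w b) j i = e b (w' b) j i) →
      ∀ i : Fin (max n m), (i : ℕ) < n →
        (e a (w a) j + topBits m (delay (e b (w b)) j)) i =
          (e a (w' a) j + topBits m (delay (e b (w' b)) j)) i := by
    intro j hj hb
    have hy := h j hj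
    rw [output_eq, output_eq, channelOutput_eq, channelOutput_eq, input_relayCode_other,
      input_relayCode_other, input_relayCode_self hF, input_relayCode_self hF,
      (shiftMatrix_mulVec_eq_iff (le_max_right n m) _ _).2 hb] at hy
    exact (shiftMatrix_mulVec_eq_iff (le_max_left n m) _ _).1 (add_right_cancel hy)
  rcases le_total n m with hnm | hnm
  · -- There are no private levels: the relaying user has no data.
    ext j i
    rw [hlow _ _ _ (by omega), hlow _ _ _ (by omega)]
  have hb : ∀ k j, N ≤ j + 1 + k →
      ∀ i : Fin (max n m), (i : ℕ) < m → e b (w b) j i = e b (w' b) j i := by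
    intro k
    induction k with
    | zero =>
      intro j hj i _
      rw [hend b _ j hj, hend b _ j hj]
    | succ k ih =>
      intro j hj i hi
      by_cases hN : N ≤ j + 1
      · rw [hend b _ j hN, hend b _ j hN]
      · have := step (j + 1) (by omega) (ih (j + 1) (by omega)) i (by omega)
        simpa [hlow _ _ i (Or.inl hi), topBits, hi, delay] using this
  ext j i
  by_cases hN : N ≤ j + 1
  · rw [hend a _ j hN, hend a _ j hN]
  by_cases hi : (i : ℕ) < m ∨ n ≤ i
  · rw [hlow _ _ _ hi, hlow _ _ _ hi]
  · have := step j (by omega) (hb N j (by omega)) i (by omega)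
    simpa [topBits, show ¬ (i : ℕ) < m by omega] using this

/-- The other user's data is decoded from the superposition of the current and the relayed
previous signal: forwards in time if `m ≤ n`, as the current signal is then received in full, and
backwards in time if `n < m`, as the relayed one is. -/
lemma relayCode_determines_other (hF : F a a = true)
    (hinj : Function.Injective (e (1 - a)))
    (hlow : ∀ w j (i : Fin (max n m)), (i : ℕ) < m ∨ n ≤ i → e a w j i = 0)
    (hend : ∀ u w j, N ≤ j + 1 → e u w j = 0) {w w' : (u : Fin 2) → Fin (M u)}
    (h : ∀ j < N, output (relayCode N hM a e) F w j (1 - a) =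
      output (relayCode N hM a e) F w' j (1 - a)) :
    w (1 - a) = w' (1 - a) := by
  have hout : ∀ w : (u : Fin 2) → Fin (M u), ∀ j,
      output (relayCode N hM a e) F w j (1 - a) =
        (shiftMatrix (max n m) (max n m - n)).mulVec (e (1 - a) (w (1 - a)) j) +
          (shiftMatrix (max n m) (max n m - m)).mulVec (delay (e (1 - a) (w (1 - a))) j) := by
    intro w j
    rw [output_eq, channelOutput_eq, input_relayCode_other, sub_sub_cancel,
      input_relayCode_self hF]
    congr 1
    refine (shiftMatrix_mulVec_eq_iff (le_max_right n m) _ _).2 fun i hi => ?_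
    simp [hlow _ _ i (Or.inl hi), topBits, hi]
  simp only [hout] at h
  set b := 1 - a
  apply hinj
  rcases le_total m n with hnm | hnm
  · ext j : 1
    induction j with
    | zero =>
      by_cases hN : N ≤ 0 + 1
      · rw [hend b _ _ hN, hend b _ _ hN]
      have := (shiftMatrix_mulVec_eq_iff (le_max_left n m) _ _).1
        (add_right_cancel (h 0 (by omega)))
      ext i
      exact this i (by omega)
    | succ j ih =>
      by_cases hN : N ≤ j + 1 + 1
      · rw [hend b _ _ hN, hend b _ _ hN]
      have hj := h (j + 1) (by omega)
      simp only [delay, ih] at hj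
      have := (shiftMatrix_mulVec_eq_iff (le_max_left n m) _ _).1 (add_right_cancel hj)
      ext i
      exact this i (by omega)
  · have hb : ∀ k j, N ≤ j + 1 + k → e b (w b) j = e b (w' b) j := by
      intro k
      induction k with
      | zero =>
        intro j hj
        rw [hend b _ j hj, hend b _ j hj]
      | succ k ih =>
        intro j hj
        by_cases hN : N ≤ j + 1
        · rw [hend b _ j hN, hend b _ j hN]
        have hj := h (j + 1) (by omega)
        rw [ih (j + 1) (by omega)] at hj
        have := (shiftMatrix_mulVec_eq_iff (le_max_right n m) _ _).1 (add_left_cancel hj)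
        ext i
        exact this i (by omega)
    ext j : 1
    exact hb N j (by omega)

end

/-- `K` messages can be encoded injectively into `r` bit levels `s, …, s + r - 1` at the times
`0, …, N - 2`, provided that `K ≤ 2 ^ ((N - 1) * r)`. -/
lemma exists_data {q s r N K : ℕ} (hq : s + r ≤ q) (hK : K ≤ 2 ^ ((N - 1) * r)) :
    ∃ d : Fin K → ℕ → Signal q, Function.Injective d ∧
      (∀ w j (i : Fin q), (i : ℕ) < s ∨ s + r ≤ i → d w j i = 0) ∧
      ∀ w j, N ≤ j + 1 → d w j = 0 := by
  have hcard : Fintype.card (Fin K) ≤ Fintype.card (Fin (N - 1) → Fin r → ZMod 2) := by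
    simpa [← pow_mul, mul_comm] using hK
  obtain ⟨g⟩ := Function.Embedding.nonempty_of_card_le hcard
  refine ⟨fun w j i => if h : j < N - 1 ∧ s ≤ (i : ℕ) ∧ (i : ℕ) < s + r then
    g w ⟨j, h.1⟩ ⟨i - s, by omega⟩ else 0, ?_, ?_, ?_⟩
  · intro w w' h
    apply g.injective
    ext j i
    have := congrFun (congrFun h j) ⟨s + i, by omega⟩
    simpa using this
  · intro w j i hi
    exact dif_neg (by omega)
  · intro w j hj
    ext i
    exact dif_neg (by omega)

lemma exists_zero_error_code {n m N : ℕ} {M : Fin 2 → ℕ} {F : FeedbackModel} {a : Fin 2}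
    (hF : F a a = true) (hM : ∀ u, 0 < M u) (ha : M a ≤ 2 ^ ((N - 1) * (n - m)))
    (hb : M (1 - a) ≤ 2 ^ ((N - 1) * max n m)) :
    ∃ c : Code (max n m) M N, ∀ u, errorProb c F u = 0 := by
  have hdata : ∀ u, ∃ d : Fin (M u) → ℕ → Signal (max n m), Function.Injective d ∧
      (u = a → ∀ w j (i : Fin (max n m)), (i : ℕ) < m ∨ n ≤ i → d w j i = 0) ∧
      ∀ w j, N ≤ j + 1 → d w j = 0 := by
    intro u
    by_cases hu : u = a
    · subst hu
      rcases le_total n m with hnm | hnm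
      · obtain ⟨d, h1, h2, h3⟩ := exists_data (q := max n m) (s := 0) (by omega) ha
        exact ⟨d, h1, fun _ w j i _ => h2 w j i (by omega), h3⟩
      · obtain ⟨d, h1, h2, h3⟩ := exists_data (q := max n m) (s := m) (by omega) ha
        exact ⟨d, h1, fun _ w j i _ => h2 w j i (by omega), h3⟩
    · obtain rfl : u = 1 - a := by omega
      obtain ⟨d, h1, -, h3⟩ := exists_data (q := max n m) (s := 0) (by omega) hb
      exact ⟨d, h1, fun h => absurd h hu, h3⟩
  choose d hd using hdata
  refine exists_errorProb_eq_zero (relayCode N hM a d) F fun u w w' h => ?_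
  have hlow := (hd a).2.1 rfl
  have hend := fun u => (hd u).2.2
  by_cases hu : u = a
  · subst hu
    exact relayCode_determines_self hF (hd u).1 hlow hend h
  · obtain rfl : u = 1 - a := by omega
    exact relayCode_determines_other hF (hd _).1 hlow hend h

/-- The corner point approached by the relaying scheme: the relaying user `a` has the private
levels to itself, and the other user gets all levels. -/
def cornerPoint (n m : ℕ) (a u : Fin 2) : ℕ := if u = a then n - m else max n m

lemma achievable_smul_cornerPoint (n m : ℕ) {F : FeedbackModel} {a : Fin 2} (hF : F a a = true)
    {t : ℝ} (h0 : 0 ≤ t) (h1 : t < 1) :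
    Achievable n m F (fun u => t * cornerPoint n m a u) := by
  set R : Fin 2 → ℝ := fun u => t * cornerPoint n m a u with hR
  refine ⟨fun u => by positivity, ?_⟩
  have hpos := messageCount_pos R
  have hev : ∀ᶠ N : ℕ in atTop, ∃ c : Code (max n m) (messageCount R N) N,
      ∀ u, errorProb c F u = 0 := by
    -- The scheme uses `N - 1` of the `N` time slots, so it needs `N * t ≤ N - 1`.
    have h : ∀ᶠ N : ℕ in atTop, 1 ≤ (N : ℝ) * (1 - t) :=
      (tendsto_natCast_atTop_atTop.atTop_mul_const (sub_pos.2 h1)).eventually_ge_atTop 1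
    filter_upwards [h, eventually_ge_atTop 1] with N hN hN1
    have hcount : ∀ u, messageCount R N u ≤ 2 ^ ((N - 1) * cornerPoint n m a u) := by
      intro u
      refine Nat.ceil_le.2 ?_
      push_cast
      rw [← Real.rpow_natCast]
      refine Real.rpow_le_rpow_of_exponent_le one_le_two ?_
      push_cast [hN1]
      rw [hR]
      have : (N : ℝ) * t ≤ N - 1 := by linarith
      calc (N : ℝ) * (t * cornerPoint n m a u) = (N * t) * cornerPoint n m a u := by ring
        _ ≤ _ := mul_le_mul_of_nonneg_right this (by positivity)
    refine exists_zero_error_code hF (hpos N) ?_ ?_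
    · simpa [cornerPoint] using hcount a
    · simpa [cornerPoint, one_sub_ne] using hcount (1 - a)
  have hex : ∀ N, ∃ c : Code (max n m) (messageCount R N) N,
      (∃ c' : Code (max n m) (messageCount R N) N, ∀ u, errorProb c' F u = 0) →
        ∀ u, errorProb c F u = 0 := by
    intro N
    by_cases h : ∃ c' : Code (max n m) (messageCount R N) N, ∀ u, errorProb c' F u = 0
    · exact ⟨h.choose, fun _ => h.choose_spec⟩
    · exact ⟨⟨fun _ _ _ _ => 0, fun u _ => ⟨0, hpos N u⟩⟩, fun h' => absurd h' h⟩
  choose c hc using hex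
  refine ⟨c, tendsto_const_nhds.congr' ?_⟩
  filter_upwards [hev] with N hN
  rw [hc N hN 0, hc N hN 1, max_self]

lemma cornerPoint_mem_capacityRegion (n m : ℕ) {F : FeedbackModel} {a : Fin 2}
    (hF : F a a = true) : (fun u => (cornerPoint n m a u : ℝ)) ∈ capacityRegion n m F := by
  have hlim : Tendsto (fun (t : ℝ) (u : Fin 2) => t * (cornerPoint n m a u : ℝ)) (𝓝[<] 1)
      (𝓝 fun u => (cornerPoint n m a u : ℝ)) := by
    have : Continuous fun (t : ℝ) (u : Fin 2) => t * (cornerPoint n m a u : ℝ) := by fun_prop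
    simpa using (this.tendsto 1).mono_left nhdsWithin_le_nhds
  refine mem_closure_of_tendsto hlim ?_
  filter_upwards [Ioo_mem_nhdsLT (zero_lt_one (α := ℝ))] with t ht
  exact achievable_smul_cornerPoint n m hF ht.1.le ht.2

lemma le_sumCapacity (n m : ℕ) {F : FeedbackModel} {a : Fin 2} (hF : F a a = true) :
    (((max n m + (n - m) : ℕ) : ℝ) : EReal) ≤ sumCapacity n m F := by
  refine le_trans (le_of_eq ?_)
    (le_iSup₂ (f := fun (R : Fin 2 → ℝ) (_ : R ∈ capacityRegion n m F) =>
      ((R 0 + R 1 : ℝ) : EReal)) _ (cornerPoint_mem_capacityRegion n m hF))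
  rw [EReal.coe_eq_coe_iff, ← Nat.cast_add]
  fin_cases a
  · simp [cornerPoint, add_comm]
  · simp [cornerPoint]

lemma sumCapacity_eq (n m : ℕ) {F : FeedbackModel} (hF : F 0 0 = true ∨ F 1 1 = true) :
    sumCapacity n m F = ((max ((n : ℝ) - (m : ℝ)) 0 + max (n : ℝ) (m : ℝ) : ℝ) : EReal) := by
  have hval : ((max n m + (n - m) : ℕ) : ℝ) = max ((n : ℝ) - m) 0 + max (n : ℝ) m := by
    rcases le_total n m with h | h
    · have h' : (n : ℝ) ≤ m := by exact_mod_cast h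
      simp [h, h']
    · have h' : (m : ℝ) ≤ n := by exact_mod_cast h
      simp [h, h', add_comm]
  rw [← hval]
  exact le_antisymm (sumCapacity_le n m F)
    (hF.elim (fun h => le_sumCapacity n m h) fun h => le_sumCapacity n m h)

end DetIC

theorem mainTheorem1 (n m : ℕ) (F : DetIC.FeedbackModel)
    (hF : F 0 0 = true ∨ F 1 1 = true) :
    DetIC.sumCapacity n m (DetIC.model true false false false) = DetIC.sumCapacity n m F ∧
    DetIC.sumCapacity n m F = DetIC.sumCapacity n m (DetIC.model true true true true) ∧
    DetIC.sumCapacity n m (DetIC.model true true true true) =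
      ((max ((n : ℝ) - (m : ℝ)) 0 + max (n : ℝ) (m : ℝ) : ℝ) : EReal) := by
  have h1 := DetIC.sumCapacity_eq n m (F := DetIC.model true false false false) (Or.inl rfl)
  have h2 := DetIC.sumCapacity_eq n m (F := DetIC.model true true true true) (Or.inl rfl)
  have h := DetIC.sumCapacity_eq n m hF
  exact ⟨h1.trans h.symm, h.trans h2.symm, h2⟩
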